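/- Let $\mathsf L\in\{\mathrm{SUM},\mathrm{OR},\mathrm{XOR}\}$. A rectangle of size $a\times b$ in a boolean matrix format is a boolean matrix whose ones form exactly a product $S\times T$ of a nonempty set $S$ of $a$ rows and a nonempty set $T$ of $b$ columns. For such an $R$ put $w(R)=a+b$, $\sigma(R)=\sqrt{ab}$ and $\rho(R)=\max(a,b)/\min(a,b)$. A finite set $F$ of rectangles is an $\mathsf L$-covering of a boolean matrix $A$ if $A=\sum_{R\in F}R$, where the sum is integer addition for SUM, disjunction for OR and addition modulo $2$ for XOR. Put $w(F)=\sum_{R\in F}w(R)$ and $\sigma(F)=\sum_{R\in F}\sigma(R)$, and let $\mathsf L_2(A)$ (the depth-2 complexity of $A$) be the minimum of $w(F)$ over all $\mathsf L$-coverings $F$ of $A$. For a covering $F=\{R_1,\dots,R_s\}$ by $a_i\times b_i$ rectangles $R_i$ let $$\chi_F(x)=\sum_{i=1}^{s}\sigma(R_i)\left(\frac{a_i}{b_i}\right)^x-\sigma(F).$$ $F$ is called compact if $\chi_F(x)<0$ for some $x<0$. For compact $F$ let $\lambda_F$ be the least real root of $\chi_F$ such that $\chi_F$ is negative in a right neighbourhood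 of the root; if there is no such root (for compact $F$ this happens exactly when $a_i\ge b_i$ for all $i$), put $\lambda_F=-\infty$. A covering $G$ is called one-sided if $a'\ge b'$ for every $a'\times b'$ rectangle of $G$; put $$\mu_G=\frac1{\sigma(G)}\sum_{R\in G}\frac{\sigma(R)}{\sqrt{\rho(R)}}.$$ Theorem. Let $A$ be a symmetric boolean $r\times r$ matrix, let $F$ be a compact $\mathsf L$-covering of $A$, and let $G$ be a compact one-sided $\mathsf L$-covering of $A$ with $\sigma(G)\ge\sigma(F)$. Suppose that $$\frac{\sigma(G)}{\sigma(F)}<\mu_G^{2\lambda_F}$$ (if $\lambda_F=-\infty$, the right-hand side is read as $+\infty$, since $0<\mu_G<1$, and the condition holds). Then there is a constant $C$ such that for all $n\ge0$, with $N=r^n$, $$\mathsf L_2(A^{\otimes n})\le C\,N^{\log_r\sigma(F)},$$ where $A^{\otimes n}$ is the $n$-th Kronecker power of $A$. -/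

import Mathlib

open Filter Topology

namespace KronCover

/-- The operation used for adding up the rectangles of a covering: integer addition, disjunction,
or addition modulo 2. -/
inductive Op where
  | SUM
  | OR
  | XOR

/-- A rectangle in a matrix with rows `ι` and columns `κ`: a nonempty set of rows and a nonempty set
of columns. -/
@[ext] structure Rect (ι κ : Type*) where
  rows : Finset ι
  cols : Finset κ
  rows_nonempty : rows.Nonempty
  cols_nonempty : cols.Nonempty

namespace Rect

variable {ι κ : Type*}

/-- The boolean matrix of rank 1 with ones exactly on the rectangle. -/
def toMatrix [DecidableEq ι] [DecidableEq κ] (R : Rect ι κ) : Matrix ι κ Bool :=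
  Matrix.of fun i j => decide (i ∈ R.rows ∧ j ∈ R.cols)

/-- The number of rows. -/
def height (R : Rect ι κ) : ℕ := R.rows.card

/-- The number of columns. -/
def width (R : Rect ι κ) : ℕ := R.cols.card

/-- The complexity `w(R) = a + b` of an `a × b` rectangle. -/
def complexity (R : Rect ι κ) : ℕ := R.height + R.width

/-- The narrowness `ρ(R) = max(a, b) / min(a, b)` of an `a × b` rectangle. -/
noncomputable def narrowness (R : Rect ι κ) : ℝ :=
  (max R.height R.width : ℕ) / (min R.height R.width : ℕ)

/-- The spectral weight `σ(R) = √(a b)` of an `a × b` rectangle. -/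
noncomputable def spectralWeight (R : Rect ι κ) : ℝ :=
  √((R.height : ℝ) * (R.width : ℝ))

end Rect

section Coverings

variable {ι κ : Type*}

/-- `IsCovering L F A`: the sum of the rectangles of `F` (as matrices of rank 1) in the sense of the
operation `L` is the boolean matrix `A`. -/
def IsCovering [DecidableEq ι] [DecidableEq κ] (L : Op) (F : Finset (Rect ι κ))
    (A : Matrix ι κ Bool) : Prop :=
  match L with
  | .SUM => ∀ i j, ∑ R ∈ F, (R.toMatrix i j).toNat = (A i j).toNat
  | .OR => ∀ i j, (F.sup fun R => R.toMatrix i j) = A i j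
  | .XOR => ∀ i j, ∑ R ∈ F, ((R.toMatrix i j).toNat : ZMod 2) = ((A i j).toNat : ZMod 2)

/-- The complexity `w(F)` of a set of rectangles. -/
def complexity (F : Finset (Rect ι κ)) : ℕ := ∑ R ∈ F, R.complexity

/-- The spectral weight `σ(F)` of a set of rectangles. -/
noncomputable def spectralWeight (F : Finset (Rect ι κ)) : ℝ := ∑ R ∈ F, R.spectralWeight

/-- The depth-2 complexity `L₂(A)`: the minimal complexity of an `L`-covering of `A`. -/
noncomputable def depthTwoComplexity [DecidableEq ι] [DecidableEq κ] (L : Op)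
    (A : Matrix ι κ Bool) : ℕ :=
  sInf {w : ℕ | ∃ F : Finset (Rect ι κ), IsCovering L F A ∧ complexity F = w}

/-- The `1 × 1` rectangle at a given position. -/
def Rect.single (p : ι × κ) : Rect ι κ :=
  ⟨{p.1}, {p.2}, Finset.singleton_nonempty _, Finset.singleton_nonempty _⟩

/-- Every finite boolean matrix has a covering of each type, so the minimum that defines
`depthTwoComplexity` is attained. -/
theorem exists_isCovering [Fintype ι] [Fintype κ] [DecidableEq ι] [DecidableEq κ] (L : Op)
    (A : Matrix ι κ Bool) : ∃ F : Finset (Rect ι κ), IsCovering L F A := by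
  have hinj : Function.Injective (Rect.single : ι × κ → Rect ι κ) := by
    intro p q h
    have h1 := congrArg Rect.rows h
    have h2 := congrArg Rect.cols h
    simp only [Rect.single, Finset.singleton_inj] at h1 h2
    exact Prod.ext h1 h2
  have hent : ∀ (p : ι × κ) i j, (Rect.single p).toMatrix i j = decide (p = (i, j)) := by
    intro p i j
    simp [Rect.toMatrix, Rect.single, Prod.ext_iff, eq_comm]
  refine ⟨(Finset.univ.filter fun p : ι × κ => A p.1 p.2 = true).map ⟨_, hinj⟩, ?_⟩
  cases L with
  | SUM =>
    intro i j
    rw [Finset.sum_map]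
    simp only [Function.Embedding.coeFn_mk, hent]
    cases h : A i j <;> simp [Bool.toNat, Bool.cond_decide, Finset.sum_ite_eq', h]
  | OR =>
    intro i j
    rw [Finset.sup_map, Bool.eq_iff_iff]
    have hsup : ∀ (s : Finset (ι × κ)) (f : ι × κ → Bool),
        s.sup f = true ↔ ∃ p ∈ s, f p = true := by
      intro s f
      classical
      induction s using Finset.induction_on with
      | empty => simp
      | insert a s _ ih => simp [Finset.sup_insert, ih]
    rw [hsup]
    simp [hent]
  | XOR =>
    intro i j
    rw [Finset.sum_map]
    simp only [Function.Embedding.coeFn_mk, hent]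
    cases h : A i j <;>
      simp [Bool.toNat, Bool.cond_decide, Finset.sum_ite_eq', h]

/-- The characteristic function
`χ_F(x) = ∑ σ(R) (a / b) ^ x - σ(F)`, summed over the `a × b` rectangles `R` of `F`. -/
noncomputable def charFun (F : Finset (Rect ι κ)) (x : ℝ) : ℝ :=
  ∑ R ∈ F, R.spectralWeight * ((R.height : ℝ) / (R.width : ℝ)) ^ x - spectralWeight F

/-- `F` is compact if its characteristic function is negative at some negative argument. -/
def IsCompactCovering (F : Finset (Rect ι κ)) : Prop := ∃ x < 0, charFun F x < 0

/-- `F` is one-sided (with respect to the rows): no rectangle has fewer rows than columns. -/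
def IsOneSided (F : Finset (Rect ι κ)) : Prop := ∀ R ∈ F, R.width ≤ R.height

/-- `IsMinimalRoot F lam`: `lam` is the least real root of the characteristic function of `F` such
that this function is negative in a right neighbourhood of the root. -/
def IsMinimalRoot (F : Finset (Rect ι κ)) (lam : ℝ) : Prop :=
  IsLeast {x : ℝ | charFun F x = 0 ∧ ∀ᶠ y in 𝓝[>] x, charFun F y < 0} lam

/-- The coefficient `μ_G = (1 / σ(G)) ∑ σ(R) / √ρ(R)`. -/
noncomputable def compensation (G : Finset (Rect ι κ)) : ℝ :=
  1 / spectralWeight G * ∑ R ∈ G, R.spectralWeight / √R.narrowness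

end Coverings

/-- The Kronecker power `A^{⊗n}` of a boolean matrix; its rows and columns are indexed by the
`n`-tuples of row and column indices of `A`, and its entries are the conjunctions (products) of the
corresponding entries of `A`. For `n = 0` it is the `1 × 1` matrix with entry 1. -/
def kroneckerPower {ι κ : Type*} (A : Matrix ι κ Bool) (n : ℕ) :
    Matrix (Fin n → ι) (Fin n → κ) Bool :=
  Matrix.of fun x y => decide (∀ k, A (x k) (y k) = true)

/-- `A^{⊗(n+1)}` is the Kronecker product of `A` and `A^{⊗n}`. -/
theorem kroneckerPower_succ {ι κ : Type*} (A : Matrix ι κ Bool) (n : ℕ) (i : ι) (j : κ)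
    (x : Fin n → ι) (y : Fin n → κ) :
    kroneckerPower A (n + 1) (Fin.cons i x) (Fin.cons j y) =
      Matrix.kroneckerMap (· && ·) A (kroneckerPower A n) (i, x) (j, y) := by
  simp [kroneckerPower, Fin.forall_fin_succ]

end KronCover

/-!
Since `A` is a Kronecker factor of `A^{⊗(n+1)}`, a covering of `A^{⊗(n+1)}` arises from a covering
`E` of `A` when every rectangle `R ∈ E` is multiplied by a covering of `A^{⊗n}`, which may depend
on `R`. The spectral weight is multiplicative, so using `F` throughout produces the total spectral
weight `σ(F) ^ n`, and the theorem amounts to keeping the average of `√(a/b) + √(b/a)` over the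
resulting `a × b` rectangles bounded (`imbalance (1 / 2)`). This is a matter of controlling a random
walk: choosing `R ∈ E` with probability proportional to `σ(R)` multiplies the aspect ratio by that
of `R`. As `A` is symmetric, coverings may be transposed, so it may be assumed that the current
aspect ratio `z` is at most 1, and compactness says that `F` then pushes `z` upwards.

If `χ_F(-1/2) < 0`, the imbalance of order `1/2` is contracted by `F` up to an additive error, and
`F` alone suffices. Otherwise `χ_F` has a minimal root `λ ∈ [-1/2, 0)`
(`IsCompactCovering.exists_isMinimalRoot`), and `F` contracts the imbalance `z ^ c + z ^ (-c)` only
for `c < -λ`. By Jensen's inequality and the condition on `λ`, the covering `G` contracts the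
imbalances of order `c` and of order `1/2`, even after its excess weight `σ(G) / σ(F)` is taken into
account, when `c` is close to `-λ` (`exists_moment_lt`). With `n` factors left, `G` is used when the
aspect ratio is more extreme than a threshold growing exponentially in `n`, and `F` is used
otherwise. The excess weight caused by `G` is then summable over `n`, as is what the use of `F`
contributes to the imbalance of order `1/2`. The induction on `n` is carried by an explicit
`potential`, a bound for the optimal normalized cost as a function of `n` and `z`
(`exists_isCovering_cost_le_potential`).
-/

namespace KronCover

/-! ### Products and transposes of rectangles -/

theorem product_inj {α β : Type*} {s s' : Finset α} {t t' : Finset β} (hs : s.Nonempty)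
    (ht : t.Nonempty) (h : s ×ˢ t = s' ×ˢ t') : s = s' ∧ t = t' := by
  have h' := congrArg (fun u : Finset (α × β) => (u : Set (α × β))) h
  simp only [Finset.coe_product] at h'
  rw [Set.prod_eq_prod_iff_of_nonempty (by simpa using ⟨hs, ht⟩)] at h'
  exact_mod_cast h'

theorem cons_mem_map_product {α : Type*} {n : ℕ} (s : Finset α) (t : Finset (Fin n → α)) (a : α)
    (f : Fin n → α) :
    (Fin.cons a f : Fin (n + 1) → α) ∈ (s ×ˢ t).map (Fin.consEquiv fun _ => α).toEmbedding ↔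
      a ∈ s ∧ f ∈ t :=
  (Finset.mem_map' (Fin.consEquiv fun _ => α).toEmbedding (a := (a, f))).trans Finset.mem_product

namespace Rect

variable {ι κ : Type*}

/-- The aspect ratio `a / b` of an `a × b` rectangle. -/
noncomputable def aspect (R : Rect ι κ) : ℝ := (R.height : ℝ) / (R.width : ℝ)

theorem height_pos (R : Rect ι κ) : (0 : ℝ) < R.height :=
  Nat.cast_pos.2 (Finset.card_pos.2 R.rows_nonempty)

theorem width_pos (R : Rect ι κ) : (0 : ℝ) < R.width :=
  Nat.cast_pos.2 (Finset.card_pos.2 R.cols_nonempty)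

theorem aspect_pos (R : Rect ι κ) : 0 < R.aspect := div_pos R.height_pos R.width_pos

theorem spectralWeight_pos (R : Rect ι κ) : 0 < R.spectralWeight :=
  Real.sqrt_pos.2 (mul_pos R.height_pos R.width_pos)

theorem toMatrix_apply [DecidableEq ι] [DecidableEq κ] (R : Rect ι κ) (i : ι) (j : κ) :
    R.toMatrix i j = decide (i ∈ R.rows ∧ j ∈ R.cols) := rfl

/-- The transposed rectangle. -/
def transpose (R : Rect ι κ) : Rect κ ι :=
  ⟨R.cols, R.rows, R.cols_nonempty, R.rows_nonempty⟩

theorem transpose_injective : Function.Injective (transpose : Rect ι κ → Rect κ ι) := by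
  intro R S h
  exact Rect.ext (congrArg Rect.cols h) (congrArg Rect.rows h)

theorem toMatrix_transpose [DecidableEq ι] [DecidableEq κ] (R : Rect ι κ) (i : ι) (j : κ) :
    R.transpose.toMatrix j i = R.toMatrix i j := by
  simp [toMatrix_apply, transpose, and_comm]

theorem spectralWeight_transpose (R : Rect ι κ) :
    R.transpose.spectralWeight = R.spectralWeight := by
  simp [spectralWeight, transpose, height, width, mul_comm]

theorem aspect_transpose (R : Rect ι κ) : R.transpose.aspect = R.aspect⁻¹ := by
  simp [aspect, transpose, height, width]

/-- The Kronecker product of a rectangle in `A` with a rectangle in `A^{⊗n}`, a rectangle in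
`A^{⊗(n+1)}`; the new coordinate is put in front. -/
def kron {n : ℕ} (R : Rect ι κ) (S : Rect (Fin n → ι) (Fin n → κ)) :
    Rect (Fin (n + 1) → ι) (Fin (n + 1) → κ) where
  rows := (R.rows ×ˢ S.rows).map (Fin.consEquiv fun _ => ι).toEmbedding
  cols := (R.cols ×ˢ S.cols).map (Fin.consEquiv fun _ => κ).toEmbedding
  rows_nonempty := (R.rows_nonempty.product S.rows_nonempty).map
  cols_nonempty := (R.cols_nonempty.product S.cols_nonempty).map

/-- The factors of a product of rectangles are its projections, as all sides are nonempty. -/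
theorem kron_injective {n : ℕ} :
    Function.Injective fun p : (_ : Rect ι κ) × Rect (Fin n → ι) (Fin n → κ) =>
      p.1.kron p.2 := by
  rintro ⟨R, S⟩ ⟨R', S'⟩ h
  have hr := Finset.map_injective _ (congrArg Rect.rows h)
  have hc := Finset.map_injective _ (congrArg Rect.cols h)
  obtain ⟨h1, h2⟩ := product_inj R.rows_nonempty S.rows_nonempty hr
  obtain ⟨h3, h4⟩ := product_inj R.cols_nonempty S.cols_nonempty hc
  rw [Rect.ext h1 h3, Rect.ext h2 h4]

theorem toMatrix_kron [DecidableEq ι] [DecidableEq κ] {n : ℕ} (R : Rect ι κ)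
    (S : Rect (Fin n → ι) (Fin n → κ)) (i : ι) (j : κ) (x : Fin n → ι) (y : Fin n → κ) :
    (R.kron S).toMatrix (Fin.cons i x) (Fin.cons j y) = (R.toMatrix i j && S.toMatrix x y) := by
  simp only [toMatrix_apply, kron, cons_mem_map_product, ← Bool.decide_and]
  exact decide_eq_decide.2 (by tauto)

theorem height_kron {n : ℕ} (R : Rect ι κ) (S : Rect (Fin n → ι) (Fin n → κ)) :
    (R.kron S).height = R.height * S.height := by
  simp [height, kron]

theorem width_kron {n : ℕ} (R : Rect ι κ) (S : Rect (Fin n → ι) (Fin n → κ)) :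
    (R.kron S).width = R.width * S.width := by
  simp [width, kron]

theorem spectralWeight_kron {n : ℕ} (R : Rect ι κ) (S : Rect (Fin n → ι) (Fin n → κ)) :
    (R.kron S).spectralWeight = R.spectralWeight * S.spectralWeight := by
  rw [spectralWeight, spectralWeight, spectralWeight,
    ← Real.sqrt_mul (mul_pos R.height_pos R.width_pos).le, height_kron, width_kron]
  push_cast
  ring_nf

theorem aspect_kron {n : ℕ} (R : Rect ι κ) (S : Rect (Fin n → ι) (Fin n → κ)) :
    (R.kron S).aspect = R.aspect * S.aspect := by
  simp only [aspect, height_kron, width_kron, Nat.cast_mul]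
  exact mul_div_mul_comm _ _ _ _

end Rect

/-! ### Products and transposes of coverings -/

section Coverings

variable {ι κ : Type*} [DecidableEq ι] [DecidableEq κ]

theorem IsCovering.transpose {L : Op} {F : Finset (Rect ι κ)} {A : Matrix ι κ Bool}
    (h : IsCovering L F A) :
    IsCovering L (F.map ⟨Rect.transpose, Rect.transpose_injective⟩) A.transpose := by
  cases L <;> intro i j <;>
    simpa [Finset.sum_map, Finset.sup_map, Function.comp_def, Rect.toMatrix_transpose] using h j i

/-- If every rectangle `R` of a covering of `A` is multiplied by its own covering of `A^{⊗n}`, the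
products form a covering of `A^{⊗(n+1)}`. -/
theorem IsCovering.kron {L : Op} {F : Finset (Rect ι κ)} {A : Matrix ι κ Bool} {n : ℕ}
    (hF : IsCovering L F A) {H : Rect ι κ → Finset (Rect (Fin n → ι) (Fin n → κ))}
    (hH : ∀ R, IsCovering L (H R) (kroneckerPower A n)) :
    IsCovering L ((F.sigma H).map ⟨_, Rect.kron_injective⟩) (kroneckerPower A (n + 1)) := by
  have hand : ∀ a b : Bool, (a && b).toNat = a.toNat * b.toNat := by decide
  cases L with
  | SUM =>
    intro x y
    induction x using Fin.consCases with | _ i x => ?_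
    induction y using Fin.consCases with | _ j y => ?_
    simp only [Finset.sum_map, Function.Embedding.coeFn_mk, Finset.sum_sigma, Rect.toMatrix_kron,
      kroneckerPower_succ, Matrix.kroneckerMap_apply, hand, ← Finset.mul_sum]
    rw [Finset.sum_congr rfl fun R _ => by rw [hH R x y], ← Finset.sum_mul, hF i j]
  | OR =>
    intro x y
    induction x using Fin.consCases with | _ i x => ?_
    induction y using Fin.consCases with | _ j y => ?_
    have hinf : ∀ a b : Bool, (a && b) = a ⊓ b := by decide
    rw [Finset.sup_map]
    simp only [Function.comp_def, Function.Embedding.coeFn_mk, Finset.sup_sigma,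
      Rect.toMatrix_kron, kroneckerPower_succ, Matrix.kroneckerMap_apply, hinf,
      ← Finset.sup_inf_distrib_left]
    rw [Finset.sup_congr rfl fun R _ => by rw [hH R x y], ← Finset.sup_inf_distrib_right, hF i j]
  | XOR =>
    intro x y
    induction x using Fin.consCases with | _ i x => ?_
    induction y using Fin.consCases with | _ j y => ?_
    simp only [Finset.sum_map, Function.Embedding.coeFn_mk, Finset.sum_sigma, Rect.toMatrix_kron,
      kroneckerPower_succ, Matrix.kroneckerMap_apply, hand, Nat.cast_mul, ← Finset.mul_sum]
    rw [Finset.sum_congr rfl fun R _ => by rw [hH R x y], ← Finset.sum_mul, hF i j]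

theorem isCovering_kroneckerPower_zero (L : Op) (A : Matrix ι κ Bool) :
    IsCovering L {Rect.single (Fin.elim0, Fin.elim0)} (kroneckerPower A 0) := by
  cases L <;> intro i j <;>
    simp [kroneckerPower, Rect.single, Rect.toMatrix_apply, eq_iff_true_of_subsingleton]

end Coverings

/-! ### The cost of a covering relative to an aspect ratio -/

/-- `imbalance x z = z ^ x + z ^ (-x)`. For `x = 1/2` it is the quotient `(a + b) / √(a b)` of
complexity and spectral weight for rectangles with aspect ratio `z = a / b`. -/
noncomputable def imbalance (x z : ℝ) : ℝ := z ^ x + z ^ (-x)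

theorem imbalance_inv (x : ℝ) {z : ℝ} (hz : 0 < z) : imbalance x z⁻¹ = imbalance x z := by
  rw [imbalance, imbalance, Real.inv_rpow hz.le, Real.inv_rpow hz.le, Real.rpow_neg hz.le, inv_inv,
    add_comm]

theorem imbalance_pos (x : ℝ) {z : ℝ} (hz : 0 < z) : 0 < imbalance x z :=
  add_pos (Real.rpow_pos_of_pos hz _) (Real.rpow_pos_of_pos hz _)

section Cost

variable {ι κ : Type*}

/-- The complexity of the products of the rectangles of `F` with a fixed rectangle of aspect ratio
`z` and spectral weight 1. -/
noncomputable def cost (z : ℝ) (F : Finset (Rect ι κ)) : ℝ :=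
  ∑ R ∈ F, R.spectralWeight * imbalance (1 / 2) (z * R.aspect)

theorem Rect.spectralWeight_mul_imbalance (R : Rect ι κ) :
    R.spectralWeight * imbalance (1 / 2) R.aspect = R.complexity := by
  have ha := R.height_pos
  have hb := R.width_pos
  rw [imbalance, Real.rpow_neg R.aspect_pos.le, ← Real.sqrt_eq_rpow, Rect.aspect,
    Rect.spectralWeight, Rect.complexity, Real.sqrt_mul ha.le, Real.sqrt_div ha.le]
  have ha' := Real.sqrt_pos.2 ha
  have hb' := Real.sqrt_pos.2 hb
  have h1 := Real.sq_sqrt ha.le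
  have h2 := Real.sq_sqrt hb.le
  push_cast
  field_simp
  rw [h1, h2]

theorem cost_one (F : Finset (Rect ι κ)) : cost 1 F = complexity F := by
  simp only [cost, complexity, one_mul, Rect.spectralWeight_mul_imbalance, Nat.cast_sum]

theorem cost_transpose {z : ℝ} (hz : 0 < z) (F : Finset (Rect ι κ)) :
    cost z (F.map ⟨Rect.transpose, Rect.transpose_injective⟩) = cost z⁻¹ F := by
  simp only [cost, Finset.sum_map, Function.Embedding.coeFn_mk, Rect.spectralWeight_transpose,
    Rect.aspect_transpose]
  refine Finset.sum_congr rfl fun R _ => ?_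
  rw [← imbalance_inv _ (mul_pos hz (inv_pos.2 R.aspect_pos)), mul_inv, inv_inv]

theorem cost_kron {n : ℕ} (z : ℝ) (F : Finset (Rect ι κ))
    (H : Rect ι κ → Finset (Rect (Fin n → ι) (Fin n → κ))) :
    cost z ((F.sigma H).map ⟨_, Rect.kron_injective⟩) =
      ∑ R ∈ F, R.spectralWeight * cost (z * R.aspect) (H R) := by
  simp only [cost, Finset.sum_map, Function.Embedding.coeFn_mk, Finset.sum_sigma,
    Rect.spectralWeight_kron, Rect.aspect_kron, Finset.mul_sum, mul_assoc]

/-- The sum `∑ σ(R) (a / b) ^ x` over the `a × b` rectangles `R` of `F`. -/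
noncomputable def moment (F : Finset (Rect ι κ)) (x : ℝ) : ℝ :=
  ∑ R ∈ F, R.spectralWeight * R.aspect ^ x

theorem moment_nonneg (F : Finset (Rect ι κ)) (x : ℝ) : 0 ≤ moment F x :=
  Finset.sum_nonneg fun R _ =>
    (mul_pos R.spectralWeight_pos (Real.rpow_pos_of_pos R.aspect_pos x)).le

theorem charFun_eq (F : Finset (Rect ι κ)) (x : ℝ) :
    charFun F x = moment F x - spectralWeight F := rfl

theorem moment_zero (F : Finset (Rect ι κ)) : moment F 0 = spectralWeight F := by
  simp [moment, spectralWeight]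

theorem sum_imbalance (F : Finset (Rect ι κ)) (x : ℝ) {z : ℝ} (hz : 0 < z) :
    ∑ R ∈ F, R.spectralWeight * imbalance x (z * R.aspect) =
      moment F x * z ^ x + moment F (-x) * z ^ (-x) := by
  simp only [moment, Finset.sum_mul, ← Finset.sum_add_distrib]
  refine Finset.sum_congr rfl fun R _ => ?_
  rw [imbalance, Real.mul_rpow hz.le R.aspect_pos.le, Real.mul_rpow hz.le R.aspect_pos.le]
  ring

theorem sum_imbalance_le_mul (F : Finset (Rect ι κ)) {x z K : ℝ} (hz : 0 < z)
    (h1 : moment F x ≤ K) (h2 : moment F (-x) ≤ K) :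
    ∑ R ∈ F, R.spectralWeight * imbalance x (z * R.aspect) ≤ K * imbalance x z := by
  rw [sum_imbalance F x hz, imbalance, mul_add]
  have := Real.rpow_pos_of_pos hz x
  have := Real.rpow_pos_of_pos hz (-x)
  gcongr

/-- If `F` tends to raise the aspect ratio, it lowers the imbalance of flat rectangles, up to an
additive error for the possible overshooting. -/
theorem sum_imbalance_le (F : Finset (Rect ι κ)) {x z d K : ℝ} (hx : 0 ≤ x) (hz : 0 < z)
    (hz1 : z ≤ 1) (h1 : moment F x ≤ K) (h2 : moment F (-x) ≤ d) :
    ∑ R ∈ F, R.spectralWeight * imbalance x (z * R.aspect) ≤ d * imbalance x z + K := by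
  rw [sum_imbalance F x hz, imbalance, mul_add]
  have hd : 0 ≤ d := (moment_nonneg F _).trans h2
  have hp := Real.rpow_pos_of_pos hz x
  have hn := Real.rpow_pos_of_pos hz (-x)
  have hp1 : z ^ x ≤ 1 := Real.rpow_le_one hz.le hz1 hx
  have e1 : moment F x * z ^ x ≤ K :=
    (mul_le_of_le_one_right (moment_nonneg F x) hp1).trans h1
  have e2 : moment F (-x) * z ^ (-x) ≤ d * z ^ (-x) := by gcongr
  have e3 : 0 ≤ d * z ^ x := by positivity
  linarith

theorem exists_isCovering_cost_kron [DecidableEq ι] [DecidableEq κ] {L : Op}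
    {F : Finset (Rect ι κ)} {A : Matrix ι κ Bool} (hF : IsCovering L F A) {n : ℕ} {z : ℝ}
    (hz : 0 < z) {U : ℝ → ℝ}
    (hU : ∀ z > 0, ∃ H, IsCovering L H (kroneckerPower A n) ∧ cost z H ≤ U z) :
    ∃ H, IsCovering L H (kroneckerPower A (n + 1)) ∧
      cost z H ≤ ∑ R ∈ F, R.spectralWeight * U (z * R.aspect) := by
  choose H hH using fun R : Rect ι κ => hU (z * R.aspect) (mul_pos hz R.aspect_pos)
  refine ⟨_, hF.kron fun R => (hH R).1, ?_⟩
  rw [cost_kron]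
  exact Finset.sum_le_sum fun R _ => mul_le_mul_of_nonneg_left (hH R).2 R.spectralWeight_pos.le

end Cost

/-! ### Mixing two coverings -/

/-- The potential that bounds the normalized cost of the coverings of `A^{⊗n}` relative to the
aspect ratio `z`. The bounded first term stands for the total spectral weight, the second one is
the potential contracted by both coverings, and the last one is the imbalance to be estimated. -/
noncomputable def potential (a B e d c : ℝ) (n : ℕ) (z : ℝ) : ℝ :=
  a * (1 - e ^ n) + B * e ^ n * imbalance c z + d ^ n * imbalance (1 / 2) z

theorem sum_mul_potential {ι κ : Type*} (E : Finset (Rect ι κ)) (s a B e d c z : ℝ) (n : ℕ) :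
    ∑ R ∈ E, R.spectralWeight * (s ^ n * potential a B e d c n (z * R.aspect)) =
      s ^ n * (a * (1 - e ^ n) * moment E 0 +
        B * e ^ n * ∑ R ∈ E, R.spectralWeight * imbalance c (z * R.aspect) +
        d ^ n * ∑ R ∈ E, R.spectralWeight * imbalance (1 / 2) (z * R.aspect)) := by
  simp only [moment, Finset.mul_sum, ← Finset.sum_add_distrib]
  refine Finset.sum_congr rfl fun R _ => ?_
  rw [potential, Real.rpow_zero]
  ring

/-- If the aspect ratio is moderate, `F` does not enlarge the total weight, and the imbalance of
order `1 / 2` is small enough to be charged to the imbalance of order `c`. -/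
theorem sum_mul_potential_le_of_moderate {ι κ : Type*} {F : Finset (Rect ι κ)}
    {s a B e d c K z : ℝ} {n : ℕ} (hs : 0 < s) (ha : 0 ≤ a) (hB : 0 ≤ B) (hd : 0 < d) (he : 0 < e)
    (he1 : e ≤ 1) (hK : 0 ≤ K) (hc : 0 ≤ c) (hz : 0 < z) (hz1 : z ≤ 1)
    (hF0 : moment F 0 ≤ s) (hF1 : moment F c ≤ K * s)
    (hF2 : moment F (-c) ≤ d * s) (hF3 : moment F (1 / 2) ≤ K * s)
    (hF4 : moment F (-(1 / 2)) ≤ K * s) (hae : a * (1 - e) = K * (B + 1))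
    (h : K * (d ^ n * imbalance (1 / 2) z) ≤ B * (e - d) * e ^ n * imbalance c z) :
    ∑ R ∈ F, R.spectralWeight * (s ^ n * potential a B e d c n (z * R.aspect)) ≤
      s ^ (n + 1) * potential a B e d c (n + 1) z := by
  rw [sum_mul_potential, pow_succ s, mul_assoc (s ^ n)]
  refine mul_le_mul_of_nonneg_left ?_ (by positivity)
  have hp1 : 0 ≤ 1 - e ^ n := sub_nonneg.2 (pow_le_one₀ he.le he1)
  have h1 := sum_imbalance_le F hc hz hz1 hF1 hF2
  have h2 := sum_imbalance_le_mul F hz hF3 hF4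
  have hae' : K * (B + 1) * e ^ n = a * (1 - e) * e ^ n := by rw [hae]
  have h5 : 0 ≤ d ^ (n + 1) * imbalance (1 / 2) z :=
    mul_nonneg (by positivity) (imbalance_pos _ hz).le
  have h6 : 0 ≤ K * e ^ n := by positivity
  have e1 := mul_le_mul_of_nonneg_left hF0 (mul_nonneg ha hp1)
  have e2 := mul_le_mul_of_nonneg_left h1 (show 0 ≤ B * e ^ n by positivity)
  have e3 := mul_le_mul_of_nonneg_left h2 (show 0 ≤ d ^ n by positivity)
  refine (add_le_add (add_le_add e1 e2) e3).trans ?_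
  calc _ = s * (a * (1 - e ^ n) + B * e ^ n * (d * imbalance c z + K) +
        K * (d ^ n * imbalance (1 / 2) z)) := by ring
    _ ≤ _ := by
        refine mul_le_mul_of_nonneg_left ?_ hs.le
        rw [potential, pow_succ e]
        linarith

/-- If the aspect ratio is extreme, `G` contracts both imbalances, and the growth of the total
weight is charged to the imbalance of order `c`. -/
theorem sum_mul_potential_le_of_extreme {ι κ : Type*} {G : Finset (Rect ι κ)}
    {s a B e d c K z : ℝ} {n : ℕ} (hs : 0 < s) (ha : 0 ≤ a) (hB : 0 ≤ B) (hd : 0 < d) (hde : d ≤ e)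
    (he1 : e ≤ 1) (hK : 0 ≤ K) (hc : 0 ≤ c) (hz : 0 < z) (hz1 : z ≤ 1)
    (hG0 : moment G 0 ≤ K * s) (hG1 : moment G c ≤ K * s)
    (hG2 : moment G (-c) ≤ d * s) (hG3 : moment G (1 / 2) ≤ K * s)
    (hG4 : moment G (-(1 / 2)) ≤ d * s) (hae : a * (1 - e) = K * (B + 1))
    (h : K * a ≤ B * (e - d) * e ^ n * imbalance c z) :
    ∑ R ∈ G, R.spectralWeight * (s ^ n * potential a B e d c n (z * R.aspect)) ≤
      s ^ (n + 1) * potential a B e d c (n + 1) z := by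
  rw [sum_mul_potential, pow_succ s, mul_assoc (s ^ n)]
  refine mul_le_mul_of_nonneg_left ?_ (by positivity)
  have he : 0 < e := hd.trans_le hde
  have hp1 : 0 ≤ 1 - e ^ n := sub_nonneg.2 (pow_le_one₀ he.le he1)
  have h1 := sum_imbalance_le G hc hz hz1 hG1 hG2
  have h2 := sum_imbalance_le G one_half_pos.le hz hz1 hG3 hG4
  have hae' : K * (B + 1) * e ^ n = a * (1 - e) * e ^ n := by rw [hae]
  have h5 : 0 ≤ K * a * e ^ n := by positivity
  have h6 : K * d ^ n ≤ K * e ^ n := by gcongr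
  have h7 : a * (1 - e) * e ^ n ≤ a * (1 - e * e ^ n) := by nlinarith
  have e1 := mul_le_mul_of_nonneg_left hG0 (mul_nonneg ha hp1)
  have e2 := mul_le_mul_of_nonneg_left h1 (show 0 ≤ B * e ^ n by positivity)
  have e3 := mul_le_mul_of_nonneg_left h2 (show 0 ≤ d ^ n by positivity)
  refine (add_le_add (add_le_add e1 e2) e3).trans ?_
  calc _ = s * (K * a - K * a * e ^ n + B * e ^ n * (d * imbalance c z + K) +
        d ^ n * (d * imbalance (1 / 2) z + K)) := by ring
    _ ≤ _ := by
        refine mul_le_mul_of_nonneg_left ?_ hs.le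
        rw [potential, pow_succ e, pow_succ d]
        linarith

/-- Induction on `n`: relative to the aspect ratio `z ≤ 1`, a covering of `A^{⊗(n+1)}` starts with
`F` if `z ≥ y d ^ n`, and with `G` otherwise. -/
theorem exists_isCovering_cost_le_potential {ι : Type*} [DecidableEq ι] {L : Op}
    {A : Matrix ι ι Bool} (hA : A.IsSymm) {F G : Finset (Rect ι ι)} (hF : IsCovering L F A)
    (hG : IsCovering L G A) {s a B e d c K q y : ℝ} (hs : 0 < s) (ha0 : 0 < a) (hB1 : 1 ≤ B)
    (hd0 : 0 < d) (hd1 : d < 1) (hde : d < e) (he1 : e < 1) (hK0 : 0 < K) (hc0 : 0 < c)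
    (hc : c ≤ 1 / 2) (hq0 : 0 < q) (hy0 : 0 < y) (hyc : y ^ c = q)
    (hen : ∀ n : ℕ, (d ^ n) ^ c = e ^ n) (hae : a * (1 - e) = K * (B + 1))
    (hKa : K * a * q ≤ B * (e - d)) (hB2 : 2 * K * y ^ (-(1 / 2) : ℝ) ≤ B * (e - d))
    (hF0 : moment F 0 ≤ s) (hF1 : moment F c ≤ K * s)
    (hF2 : moment F (-c) ≤ d * s) (hF3 : moment F (1 / 2) ≤ K * s)
    (hF4 : moment F (-(1 / 2)) ≤ K * s) (hG0 : moment G 0 ≤ K * s) (hG1 : moment G c ≤ K * s)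
    (hG2 : moment G (-c) ≤ d * s) (hG3 : moment G (1 / 2) ≤ K * s)
    (hG4 : moment G (-(1 / 2)) ≤ d * s) (n : ℕ) :
    ∀ z > 0, ∃ H, IsCovering L H (kroneckerPower A n) ∧
      cost z H ≤ s ^ n * potential a B e d c n z := by
  have he0 : 0 < e := hd0.trans hde
  have hed : 0 < e - d := sub_pos.2 hde
  have hyh : 0 < y ^ (-(1 / 2) : ℝ) := Real.rpow_pos_of_pos hy0 _
  induction n with
  | zero =>
    intro z hz
    refine ⟨_, isCovering_kroneckerPower_zero L A, ?_⟩
    have h1 := imbalance_pos c hz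
    have h2 : 0 < B * imbalance c z := by positivity
    simp only [cost, Finset.sum_singleton, Rect.spectralWeight, Rect.aspect, Rect.single,
      Rect.height, Rect.width, Finset.card_singleton, Nat.cast_one, mul_one, div_one,
      Real.sqrt_one, one_mul, potential, pow_zero, sub_self, mul_zero, zero_add]
    linarith
  | succ n ih =>
    have hstep : ∀ z > 0, z ≤ 1 → ∃ H, IsCovering L H (kroneckerPower A (n + 1)) ∧
        cost z H ≤ s ^ (n + 1) * potential a B e d c (n + 1) z := by
      intro z hz hz1
      have hp0 : 0 < e ^ n := by positivity
      have hr0 : 0 < d ^ n := by positivity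
      have hzc : 0 < z ^ c := Real.rpow_pos_of_pos hz c
      have hgc : z ^ (-c) ≤ imbalance c z := by
        rw [imbalance]
        linarith
      have hgc1 : 1 ≤ imbalance c z :=
        (Real.one_le_rpow_of_pos_of_le_one_of_nonpos hz hz1 (by linarith)).trans hgc
      have hgc0 := imbalance_pos c hz
      suffices hE : ∃ E, IsCovering L E A ∧
          ∑ R ∈ E, R.spectralWeight * (s ^ n * potential a B e d c n (z * R.aspect)) ≤
            s ^ (n + 1) * potential a B e d c (n + 1) z by
        obtain ⟨E, hE, hle⟩ := hE
        obtain ⟨H, hH, hcost⟩ := exists_isCovering_cost_kron hE hz ih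
        exact ⟨H, hH, hcost.trans hle⟩
      rcases le_or_gt (y * d ^ n) z with hcase | hcase
      · refine ⟨F, hF, sum_mul_potential_le_of_moderate hs ha0.le (by linarith) hd0 he0 he1.le
          hK0.le hc0.le hz hz1 hF0 hF1 hF2 hF3 hF4 hae ?_⟩
        have h3 : d ^ n * imbalance (1 / 2) z ≤ 2 * y ^ (-(1 / 2) : ℝ) * e ^ n := by
          have i1 : z ^ (1 / 2 : ℝ) ≤ z ^ (-(1 / 2) : ℝ) :=
            Real.rpow_le_rpow_of_exponent_ge hz hz1 (by norm_num)
          have i2 : z ^ (-(1 / 2) : ℝ) ≤ (y * d ^ n) ^ (-(1 / 2) : ℝ) :=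
            Real.rpow_le_rpow_of_nonpos (by positivity) hcase (by norm_num)
          rw [Real.mul_rpow hy0.le hr0.le] at i2
          have i3 : d ^ n * (d ^ n) ^ (-(1 / 2) : ℝ) ≤ e ^ n := by
            rw [← hen, ← Real.rpow_one_add' hr0.le (by norm_num)]
            exact Real.rpow_le_rpow_of_exponent_ge hr0 (pow_le_one₀ hd0.le hd1.le)
              (by linarith)
          calc d ^ n * imbalance (1 / 2) z
              ≤ d ^ n * (2 * (y ^ (-(1 / 2) : ℝ) * (d ^ n) ^ (-(1 / 2) : ℝ))) := by
                rw [imbalance]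
                gcongr
                linarith
            _ = 2 * y ^ (-(1 / 2) : ℝ) * (d ^ n * (d ^ n) ^ (-(1 / 2) : ℝ)) := by ring
            _ ≤ _ := by gcongr
        calc K * (d ^ n * imbalance (1 / 2) z)
            ≤ K * (2 * y ^ (-(1 / 2) : ℝ) * e ^ n) := by gcongr
          _ = 2 * K * y ^ (-(1 / 2) : ℝ) * e ^ n * 1 := by ring
          _ ≤ _ := by gcongr
      · refine ⟨G, hG, sum_mul_potential_le_of_extreme hs ha0.le (by linarith) hd0 hde.le he1.le
          hK0.le hc0.le hz hz1 hG0 hG1 hG2 hG3 hG4 hae ?_⟩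
        have h3 : 1 ≤ q * e ^ n * imbalance c z := by
          have i1 : z ^ c ≤ q * e ^ n := by
            rw [← hyc, ← hen, ← Real.mul_rpow hy0.le hr0.le]
            exact Real.rpow_le_rpow hz.le hcase.le hc0.le
          calc 1 = z ^ c * z ^ (-c) := by
                rw [Real.rpow_neg hz.le, mul_inv_cancel₀ hzc.ne']
            _ ≤ _ := by
                have := (Real.rpow_pos_of_pos hz (-c)).le
                gcongr
        calc K * a = K * a * 1 := by ring
          _ ≤ K * a * (q * e ^ n * imbalance c z) := by gcongr
          _ = K * a * q * (e ^ n * imbalance c z) := by ring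
          _ ≤ B * (e - d) * (e ^ n * imbalance c z) := by gcongr
          _ = _ := by ring
    intro z hz
    rcases le_total z 1 with hz1 | hz1
    · exact hstep z hz hz1
    · -- `A` is symmetric, so transposing a covering for `1 / z` gives one for `z`.
      obtain ⟨H, hH, hcost⟩ := hstep z⁻¹ (inv_pos.2 hz) (inv_le_one_of_one_le₀ hz1)
      have hsymm : (kroneckerPower A (n + 1)).transpose = kroneckerPower A (n + 1) := by
        ext x y
        simp [kroneckerPower, hA.apply]
      refine ⟨_, hsymm ▸ hH.transpose, ?_⟩
      rw [cost_transpose hz]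
      simpa only [potential, imbalance_inv _ hz] using hcost

/-- If `F` contracts the imbalance of order `c`, and `G` contracts the imbalances of orders `c` and
`1 / 2`, relative to `σ(F)`, then the Kronecker powers have coverings of complexity
`O(σ(F) ^ n)`. -/
theorem exists_cost_le_of_moment_lt {ι : Type*} [DecidableEq ι] {L : Op} {A : Matrix ι ι Bool}
    (hA : A.IsSymm) {F G : Finset (Rect ι ι)} (hF : IsCovering L F A) (hG : IsCovering L G A)
    (hs : 0 < spectralWeight F) {c : ℝ} (hc0 : 0 < c) (hc : c ≤ 1 / 2)
    (hFc : moment F (-c) < spectralWeight F) (hGc : moment G (-c) < spectralWeight F)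
    (hGh : moment G (-(1 / 2)) < spectralWeight F) :
    ∃ C : ℝ, ∀ n : ℕ, ∃ H, IsCovering L H (kroneckerPower A n) ∧
      cost 1 H ≤ C * spectralWeight F ^ n := by
  set s := spectralWeight F
  obtain ⟨d, hd0, hd1, hFd, hGd, hGhd⟩ : ∃ d : ℝ, 0 < d ∧ d < 1 ∧ moment F (-c) ≤ d * s ∧
      moment G (-c) ≤ d * s ∧ moment G (-(1 / 2)) ≤ d * s := by
    refine ⟨max (1 / 2) (max (moment F (-c) / s) (max (moment G (-c) / s)
      (moment G (-(1 / 2)) / s))), ?_, ?_, ?_, ?_, ?_⟩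
    · exact lt_max_of_lt_left (by norm_num)
    · simp only [max_lt_iff, div_lt_one hs]
      exact ⟨by norm_num, hFc, hGc, hGh⟩
    all_goals rw [← div_le_iff₀ hs]; simp
  obtain ⟨K, hK1, hK2, hK3, hK4, hK5, hK6, hK7⟩ : ∃ K : ℝ, 1 ≤ K ∧ moment F c ≤ K * s ∧
      moment F (1 / 2) ≤ K * s ∧ moment F (-(1 / 2)) ≤ K * s ∧ moment G 0 ≤ K * s ∧
      moment G c ≤ K * s ∧ moment G (1 / 2) ≤ K * s := by
    refine ⟨max 1 (max (moment F c / s) (max (moment F (1 / 2) / s)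
      (max (moment F (-(1 / 2)) / s) (max (moment G 0 / s)
      (max (moment G c / s) (moment G (1 / 2) / s)))))), le_max_left _ _, ?_⟩
    refine ⟨?_, ?_, ?_, ?_, ?_, ?_⟩
    all_goals rw [← div_le_iff₀ hs]; simp
  -- The rate `e` of the middle term is such that `z ^ c` has order `e ^ n` at the threshold
  -- `z = y * d ^ n` between the two coverings.
  set e : ℝ := d ^ c with he
  have he0 : 0 < e := Real.rpow_pos_of_pos hd0 c
  have he1 : e < 1 := Real.rpow_lt_one hd0.le hd1 hc0
  have hde : d < e := by
    have := Real.rpow_lt_rpow_of_exponent_gt hd0 hd1 (show c < 1 by linarith)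
    rwa [Real.rpow_one] at this
  have hen : ∀ n : ℕ, (d ^ n) ^ c = e ^ n := fun n => by
    rw [he, ← Real.rpow_natCast, ← Real.rpow_natCast, ← Real.rpow_mul hd0.le,
      ← Real.rpow_mul hd0.le, mul_comm]
  -- The constants `a` and `B` depend on each other: `a` has to absorb the additive errors, which are
  -- proportional to `B + 1`, and `B` the excess weight, proportional to `a`. A small `q` (an extreme
  -- threshold) makes the latter requirement harmless; `B` is then taken large in terms of `y`.
  set q : ℝ := (e - d) * (1 - e) / (2 * K ^ 2) with hq
  have hed : 0 < e - d := sub_pos.2 hde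
  have he1' : 0 < 1 - e := sub_pos.2 he1
  have hK0 : 0 < K := by linarith
  have hq0 : 0 < q := by positivity
  set y : ℝ := q ^ (1 / c) with hy
  have hy0 : 0 < y := Real.rpow_pos_of_pos hq0 _
  have hyc : y ^ c = q := by
    rw [hy, ← Real.rpow_mul hq0.le, one_div_mul_cancel hc0.ne', Real.rpow_one]
  have hyh : 0 < y ^ (-(1 / 2) : ℝ) := Real.rpow_pos_of_pos hy0 _
  set B : ℝ := 1 + 2 * K * y ^ (-(1 / 2) : ℝ) / (e - d) with hB
  have hB1 : 1 ≤ B := by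
    have : 0 ≤ 2 * K * y ^ (-(1 / 2) : ℝ) / (e - d) := by positivity
    linarith
  have hB2 : 2 * K * y ^ (-(1 / 2) : ℝ) ≤ B * (e - d) := by
    rw [hB, add_mul, div_mul_cancel₀ _ hed.ne']
    linarith
  set a : ℝ := K * (B + 1) / (1 - e) with ha
  have ha0 : 0 < a := by positivity
  have hae : a * (1 - e) = K * (B + 1) := div_mul_cancel₀ _ he1'.ne'
  have hKa : K * a * q ≤ B * (e - d) := by
    have : K * a * q = (B + 1) / 2 * (e - d) := by
      rw [ha, hq]
      field_simp
    rw [this]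
    gcongr
    linarith
  have hpot := exists_isCovering_cost_le_potential hA hF hG hs ha0 hB1 hd0 hd1 hde he1 hK0 hc0 hc
    hq0 hy0 hyc hen hae hKa hB2 (moment_zero F).le hK2 hFd hK3 hK4 hK5 hK6 hGd hK7 hGhd
  refine ⟨a + 2 * B + 2, fun n => ?_⟩
  obtain ⟨H, hH, hcost⟩ := hpot n 1 one_pos
  refine ⟨H, hH, hcost.trans ?_⟩
  rw [mul_comm]
  refine mul_le_mul_of_nonneg_right ?_ (by positivity)
  have h1 : 0 < e ^ n := by positivity
  have h2 : e ^ n ≤ 1 := pow_le_one₀ he0.le he1.le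
  have h3 : d ^ n ≤ 1 := pow_le_one₀ hd0.le hd1.le
  simp only [potential, imbalance, Real.one_rpow]
  nlinarith

/-! ### The characteristic function -/

section CharFun

variable {ι κ : Type*}

theorem charFun_zero (F : Finset (Rect ι κ)) : charFun F 0 = 0 := by
  rw [charFun_eq, moment_zero, sub_self]

theorem convexOn_charFun (F : Finset (Rect ι κ)) : ConvexOn ℝ Set.univ (charFun F) := by
  have h : ConvexOn ℝ Set.univ fun x => moment F x := by
    unfold moment
    classical
    induction F using Finset.induction_on with
    | empty => simpa using convexOn_const (0 : ℝ) convex_univ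
    | insert R F hR ih =>
      simp only [Finset.sum_insert hR]
      exact ((convexOn_rpow_left R.aspect_pos).smul R.spectralWeight_pos.le).add ih
  exact h.add_const (-spectralWeight F)

theorem continuous_charFun (F : Finset (Rect ι κ)) : Continuous (charFun F) :=
  (continuous_finsetSum _ fun R _ => continuous_const.mul
    (Real.continuous_const_rpow R.aspect_pos.ne')).sub continuous_const

theorem IsCompactCovering.nonempty {F : Finset (Rect ι κ)} (h : IsCompactCovering F) :
    F.Nonempty := by
  rw [Finset.nonempty_iff_ne_empty]
  rintro rfl
  obtain ⟨x, -, hx⟩ := h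
  simp [charFun, spectralWeight] at hx

theorem spectralWeight_pos_of_nonempty {F : Finset (Rect ι κ)} (h : F.Nonempty) :
    0 < spectralWeight F :=
  Finset.sum_pos (fun R _ => R.spectralWeight_pos) h

/-- A compact covering whose characteristic function is not negative at `-1/2` has a minimal root
in `[-1/2, 0)`. -/
theorem IsCompactCovering.exists_isMinimalRoot {F : Finset (Rect ι κ)} (h : IsCompactCovering F)
    (hh : 0 ≤ charFun F (-(1 / 2))) :
    ∃ lam, -(1 / 2) ≤ lam ∧ lam < 0 ∧ IsMinimalRoot F lam := by
  obtain ⟨x₀, hx₀, hneg⟩ := h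
  have hconv := convexOn_charFun F
  have hcont := continuous_charFun F
  have hx₀h : -(1 / 2) < x₀ := by
    by_contra! hle
    have hx0' : 0 < -x₀ := by linarith
    have ht : 1 / 2 / (-x₀) ≤ 1 := (div_le_one hx0').2 (by linarith)
    have ht0 : 0 < 1 / 2 / (-x₀) := by positivity
    have := hconv.2 (Set.mem_univ x₀) (Set.mem_univ 0) ht0.le (sub_nonneg.2 ht) (by ring)
    rw [smul_zero, add_zero, charFun_zero, smul_zero, add_zero, smul_eq_mul, smul_eq_mul,
      show 1 / 2 / (-x₀) * x₀ = -(1 / 2) by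
        rw [div_neg, neg_mul, div_mul_cancel₀ _ hx₀.ne]] at this
    linarith [mul_neg_of_pos_of_neg ht0 hneg]
  obtain ⟨lam, ⟨⟨hl1, hl2⟩, hl0⟩, hmax⟩ :
      ∃ lam, IsGreatest (Set.Icc (-(1 / 2)) x₀ ∩ charFun F ⁻¹' {0}) lam := by
    refine (isCompact_Icc.inter_right (isClosed_singleton.preimage hcont)).exists_isGreatest ?_
    obtain ⟨z, hz, hz0⟩ := intermediate_value_Icc' hx₀h.le hcont.continuousOn ⟨hneg.le, hh⟩
    exact ⟨z, hz, hz0⟩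
  have hl0 : charFun F lam = 0 := hl0
  have hlt : lam < x₀ := lt_of_le_of_ne hl2 (by rintro rfl; linarith)
  refine ⟨lam, hl1, by linarith, ⟨hl0, ?_⟩, ?_⟩
  · filter_upwards [Ioo_mem_nhdsGT hlt] with z hz
    by_contra! hz0
    obtain ⟨w, hw, hw0⟩ := intermediate_value_Icc' hz.2.le hcont.continuousOn ⟨hneg.le, hz0⟩
    have : w ≤ lam := hmax ⟨⟨by linarith [hw.1, hz.1], hw.2⟩, hw0⟩
    linarith [hw.1, hz.1]
  · rintro z ⟨-, hz⟩
    by_contra! hzl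
    obtain ⟨w, hw0, hw⟩ := (hz.and (Ioo_mem_nhdsGT hzl)).exists
    have := hconv.le_max_of_mem_Icc (Set.mem_univ w) (Set.mem_univ x₀) ⟨hw.2.le, hl2⟩
    rw [hl0] at this
    exact absurd this (not_le.2 (max_lt hw0 hneg))

/-! ### Moments of one-sided coverings -/

theorem IsOneSided.compensation_eq {G : Finset (Rect ι κ)} (h : IsOneSided G) :
    compensation G = moment G (-(1 / 2)) / spectralWeight G := by
  rw [compensation, one_div_mul_eq_div, moment]
  congr 1
  refine Finset.sum_congr rfl fun R hR => ?_
  rw [Rect.narrowness, max_eq_left (h R hR), min_eq_right (h R hR), ← Rect.aspect,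
    Real.sqrt_eq_rpow, Real.rpow_neg R.aspect_pos.le, div_eq_mul_inv]

theorem IsOneSided.compensation_le_one {G : Finset (Rect ι κ)} (h : IsOneSided G)
    (hG : G.Nonempty) : compensation G ≤ 1 := by
  rw [h.compensation_eq, div_le_one (spectralWeight_pos_of_nonempty hG), moment, spectralWeight]
  refine Finset.sum_le_sum fun R hR => mul_le_of_le_one_right R.spectralWeight_pos.le ?_
  refine Real.rpow_le_one_of_one_le_of_nonpos ?_ (by norm_num)
  exact (one_le_div R.width_pos).2 (Nat.cast_le.2 (h R hR))

theorem IsOneSided.compensation_pos {G : Finset (Rect ι κ)} (h : IsOneSided G)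
    (hG : G.Nonempty) : 0 < compensation G := by
  rw [h.compensation_eq]
  exact div_pos (Finset.sum_pos (fun R _ => mul_pos R.spectralWeight_pos
    (Real.rpow_pos_of_pos R.aspect_pos _)) hG) (spectralWeight_pos_of_nonempty hG)

/-- Jensen's inequality for the concave function `t ↦ t ^ (2 c)`. -/
theorem IsOneSided.moment_le {G : Finset (Rect ι κ)} (h : IsOneSided G) (hG : G.Nonempty) {c : ℝ}
    (hc0 : 0 ≤ c) (hc : c ≤ 1 / 2) :
    moment G (-c) ≤ spectralWeight G * compensation G ^ (2 * c) := by
  have hs := spectralWeight_pos_of_nonempty hG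
  have key := (Real.concaveOn_rpow (p := 2 * c) (by linarith) (by linarith)).le_map_sum
    (t := G) (w := fun R => R.spectralWeight / spectralWeight G)
    (p := fun R => R.aspect ^ (-(1 / 2) : ℝ))
    (fun R _ => (div_pos R.spectralWeight_pos hs).le)
    (by rw [← Finset.sum_div]; exact div_self hs.ne')
    (fun R _ => (Real.rpow_pos_of_pos R.aspect_pos _).le)
  simp only [smul_eq_mul, div_mul_eq_mul_div, ← Finset.sum_div] at key
  rw [div_le_iff₀' hs] at key
  rw [h.compensation_eq]
  refine le_of_eq_of_le (Finset.sum_congr rfl fun R _ => ?_) key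
  rw [← Real.rpow_mul R.aspect_pos.le]
  congr 2
  ring

end CharFun

theorem two_le_of_isCompactCovering {r : ℕ} {F : Finset (Rect (Fin r) (Fin r))}
    (h : IsCompactCovering F) : 2 ≤ r := by
  by_contra! hr
  have hcard : ∀ s : Finset (Fin r), s.Nonempty → s.card = 1 := fun s hs => by
    have h1 := Finset.card_pos.2 hs
    have h2 := s.card_le_univ
    rw [Fintype.card_fin] at h2
    omega
  obtain ⟨x, -, hx⟩ := h
  have : charFun F x = 0 := by
    simp [charFun, spectralWeight, Rect.height, Rect.width, hcard _ (Rect.rows_nonempty _),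
      hcard _ (Rect.cols_nonempty _)]
  linarith

/-- Bounds on the moments of the given coverings that make `exists_cost_le_of_moment_lt`
applicable. -/
theorem exists_moment_lt {ι κ : Type*} {F G : Finset (Rect ι κ)} (hFc : IsCompactCovering F)
    (hGs : IsOneSided G) (hσ : spectralWeight F ≤ spectralWeight G)
    (hcond : ∀ lam : ℝ, IsMinimalRoot F lam →
      spectralWeight G / spectralWeight F < compensation G ^ (2 * lam))
    (hh : 0 ≤ charFun F (-(1 / 2))) :
    ∃ c : ℝ, 0 < c ∧ c ≤ 1 / 2 ∧ moment F (-c) < spectralWeight F ∧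
      moment G (-c) < spectralWeight F ∧ moment G (-(1 / 2)) < spectralWeight F := by
  have hs := spectralWeight_pos_of_nonempty hFc.nonempty
  have hsG := hs.trans_le hσ
  have hG : G.Nonempty := by
    rw [Finset.nonempty_iff_ne_empty]
    rintro rfl
    simp [spectralWeight] at hsG
  have hμ0 := hGs.compensation_pos hG
  obtain ⟨lam, hl1, hl0, hlam⟩ := hFc.exists_isMinimalRoot hh
  -- By continuity the condition on the minimal root persists slightly to the right of it.
  have hcont : Continuous fun x : ℝ => compensation G ^ (2 * x) :=
    (Real.continuous_const_rpow hμ0.ne').comp (continuous_const.mul continuous_id)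
  have hev : ∀ᶠ x in 𝓝[>] lam, spectralWeight G / spectralWeight F < compensation G ^ (2 * x) :=
    nhdsWithin_le_nhds (hcont.continuousAt.eventually (lt_mem_nhds (hcond lam hlam)))
  obtain ⟨x, ⟨hx1, hx2⟩, hx3, hx4⟩ := ((hev.and hlam.1.2).and (Ioo_mem_nhdsGT hl0)).exists
  have hx5 : spectralWeight G * compensation G ^ (2 * -x) < spectralWeight F := by
    rw [div_lt_iff₀ hs] at hx1
    rw [mul_neg, Real.rpow_neg hμ0.le, ← div_eq_mul_inv,
      div_lt_iff₀ (Real.rpow_pos_of_pos hμ0 _), mul_comm]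
    exact hx1
  refine ⟨-x, by linarith, by linarith, ?_, ?_, ?_⟩
  · rw [neg_neg]
    rw [charFun_eq] at hx2
    linarith
  · exact (hGs.moment_le hG (by linarith) (by linarith)).trans_lt hx5
  · refine lt_of_le_of_lt ?_ hx5
    have h1 : moment G (-(1 / 2)) = spectralWeight G * compensation G := by
      rw [hGs.compensation_eq, mul_div_cancel₀ _ hsG.ne']
    rw [h1]
    refine mul_le_mul_of_nonneg_left ?_ hsG.le
    have := Real.rpow_le_rpow_of_exponent_ge hμ0 (hGs.compensation_le_one hG)
      (show 2 * -x ≤ 1 by linarith)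
    rwa [Real.rpow_one] at this

end KronCover

theorem theorem1 (L : KronCover.Op) (r : ℕ) (A : Matrix (Fin r) (Fin r) Bool) (hA : A.IsSymm)
    (F G : Finset (KronCover.Rect (Fin r) (Fin r)))
    (hF : KronCover.IsCovering L F A) (hFc : KronCover.IsCompactCovering F)
    (hG : KronCover.IsCovering L G A) (hGc : KronCover.IsCompactCovering G)
    (hGs : KronCover.IsOneSided G)
    (hσ : KronCover.spectralWeight F ≤ KronCover.spectralWeight G)
    (hcond : ∀ lam : ℝ, KronCover.IsMinimalRoot F lam →
      KronCover.spectralWeight G / KronCover.spectralWeight F <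
        KronCover.compensation G ^ (2 * lam)) :
    ∃ C : ℝ, ∀ n : ℕ,
      (KronCover.depthTwoComplexity L (KronCover.kroneckerPower A n) : ℝ) ≤
        C * ((r ^ n : ℕ) : ℝ) ^ Real.logb (r : ℝ) (KronCover.spectralWeight F) := by
  have hs := KronCover.spectralWeight_pos_of_nonempty hFc.nonempty
  obtain ⟨C, hC⟩ : ∃ C : ℝ, ∀ n : ℕ, ∃ H, KronCover.IsCovering L H (KronCover.kroneckerPower A n) ∧
      KronCover.cost 1 H ≤ C * KronCover.spectralWeight F ^ n := by
    rcases lt_or_ge (KronCover.charFun F (-(1 / 2))) 0 with hh | hh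
    · -- Here `F` contracts the imbalance of order `1 / 2` and plays both roles.
      rw [KronCover.charFun_eq, sub_neg] at hh
      exact KronCover.exists_cost_le_of_moment_lt hA hF hF hs one_half_pos le_rfl hh hh hh
    · obtain ⟨c, hc0, hc, h1, h2, h3⟩ := KronCover.exists_moment_lt hFc hGs hσ hcond hh
      exact KronCover.exists_cost_le_of_moment_lt hA hF hG hs hc0 hc h1 h2 h3
  refine ⟨C, fun n => ?_⟩
  obtain ⟨H, hH, hcost⟩ := hC n
  have hr : (2 : ℝ) ≤ r := mod_cast KronCover.two_le_of_isCompactCovering hFc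
  have hpow : ((r ^ n : ℕ) : ℝ) ^ Real.logb (r : ℝ) (KronCover.spectralWeight F) =
      KronCover.spectralWeight F ^ n := by
    rw [Nat.cast_pow, ← Real.rpow_natCast, ← Real.rpow_mul (by linarith), mul_comm,
      Real.rpow_mul (by linarith), Real.rpow_logb (by linarith) (by linarith) hs,
      Real.rpow_natCast]
  rw [hpow]
  refine le_trans ?_ hcost
  rw [KronCover.cost_one]
  exact Nat.cast_le.2 (Nat.sInf_le ⟨H, hH, rfl⟩)
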